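/- Let $G$ be a compact Hausdorff topological group acting continuously on a Polish space $E$, and let $\mu$ be a Borel probability measure on $G$ whose support is contained neither in a proper closed subgroup of $G$ nor in a coset of a proper closed normal subgroup of $G$. Let $(X_n)_{n\in\mathbf Z}$ be $E$-valued and $(V_n)_{n\in\mathbf Z}$ be $G$-valued random variables on a probability space $(\Omega,\mathcal A,P)$, such that the $V_n$ are independent with law $\mu$ and, for every $n\in\mathbf Z$, $V_{n+1}$ is independent of $((X_k,V_k))_{k\le n}$ and $X_{n+1}=V_{n+1}\cdot X_n$ almost surely. All sub-$\sigma$-algebras are completed by the $P$-negligible events. Put $$\mathcal F_{-\infty}=\bigcap_{n\in\mathbf Z}\sigma\big((X_k,V_k):k\le n\big).$$ Let $\pi:E\to G\backslash E$ be the canonical projection onto the space of orbits, which carries the quotient $\sigma$-algebra (the largest one that makes $\pi$ measurable), and let $V=(V_n)_{n\in\mathbf Z}$. Then: 1. $\mathcal F_{-\infty}$ is generated by the random variable $\pi(X_0)=G\cdot X_0$, and it is also equal to $\bigcap_{n\in\mathbf Z}\sigma(X_k:k\le n)$. 2. $X_0$ is independent of $V$ conditionally on $\mathcal F_{-\infty}$.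 3. The conditional law of $X_0$ given $\mathcal F_{-\infty}$ is the uniform law on $G\cdot X_0$: the random measure $\omega\mapsto\nu_{X_0(\omega)}$, where $\nu_x$ is the image of the normalized Haar measure of $G$ by $g\mapsto g\cdot x$, is a regular version of it. -/

import Mathlib

open MeasureTheory ProbabilityTheory
open scoped Pointwise

namespace CompactWalk

/-- The completed σ-algebra of `m`: events of `Ω` which agree with an event of `m` up to a
`P`-negligible set. (If `P` is complete this is the usual completion.) -/
@[reducible]
def completed {Ω : Type*} [mΩ : MeasurableSpace Ω] (P : Measure Ω) (m : MeasurableSpace Ω) :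
    MeasurableSpace Ω :=
  eventuallyMeasurableSpace m (ae P) ⊓ mΩ

/-- The σ-algebra generated by the variables `Y k`, `k ≤ n`. -/
@[reducible]
def past {Ω S : Type*} [MeasurableSpace S] (Y : ℤ → Ω → S) (n : ℤ) : MeasurableSpace Ω :=
  ⨆ (k : ℤ) (_ : k ≤ n), MeasurableSpace.comap (Y k) inferInstance

/-- The asymptotic σ-algebra at `-∞` of the completed natural filtration of `Y`. -/
@[reducible]
def tail {Ω S : Type*} [MeasurableSpace Ω] [MeasurableSpace S] (P : Measure Ω)
    (Y : ℤ → Ω → S) : MeasurableSpace Ω :=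
  ⨅ n : ℤ, completed P (past Y n)

/-- The σ-algebra generated by the orbit `ω ↦ G · Z ω`, where the space of orbits carries the
quotient σ-algebra, the largest one that makes the canonical projection measurable. -/
@[reducible]
def orbitSigma {Ω E : Type*} (G : Type*) [Group G] [MulAction G E] [MeasurableSpace E]
    (Z : Ω → E) : MeasurableSpace Ω :=
  MeasurableSpace.comap
    (fun ω => (Quotient.mk (MulAction.orbitRel G E) (Z ω)))
    (MeasurableSpace.map (Quotient.mk (MulAction.orbitRel G E)) inferInstance)

/-- The support of `μ` lies neither in a proper closed subgroup, nor in a coset of a proper closed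
normal subgroup. -/
structure IsSpread {G : Type*} [Group G] [TopologicalSpace G] [MeasurableSpace G]
    (μ : Measure G) : Prop where
  not_subset_subgroup : ∀ H : Subgroup G, IsClosed (H : Set G) → H ≠ ⊤ →
    ¬ μ.support ⊆ (H : Set G)
  not_subset_coset : ∀ N : Subgroup G, N.Normal → IsClosed (N : Set G) → N ≠ ⊤ →
    ∀ g : G, ¬ μ.support ⊆ g • (N : Set G)

/-- `X` is a random walk indexed by `ℤ` governed by the innovations `V` with common law `μ`. -/
structure IsWalk {Ω G E : Type*} [MeasurableSpace Ω] [MeasurableSpace G] [MeasurableSpace E]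
    [SMul G E] (P : Measure Ω) (μ : Measure G) (X : ℤ → Ω → E) (V : ℤ → Ω → G) : Prop where
  measurable_X : ∀ n, Measurable (X n)
  measurable_V : ∀ n, Measurable (V n)
  map_V : ∀ n, P.map (V n) = μ
  iIndep_V : iIndepFun V P
  indep_past : ∀ n, Indep (MeasurableSpace.comap (V (n + 1)) inferInstance)
    (past (fun k ω => (X k ω, V k ω)) n) P
  step : ∀ n, ∀ᵐ ω ∂P, X (n + 1) ω = V (n + 1) ω • X n ω

/-- `Y` and `Z` are conditionally independent given the sub-σ-algebra `m`. -/
def CondIndepGiven {Ω S T : Type*} [MeasurableSpace Ω] [MeasurableSpace S] [MeasurableSpace T]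
    (P : Measure Ω) (m : MeasurableSpace Ω) (Y : Ω → S) (Z : Ω → T) : Prop :=
  ∀ (A : Set S) (B : Set T), MeasurableSet A → MeasurableSet B →
    P⟦Y ⁻¹' A ∩ Z ⁻¹' B | m⟧ =ᵐ[P] fun ω => (P⟦Y ⁻¹' A | m⟧) ω * (P⟦Z ⁻¹' B | m⟧) ω

/-- `κ` is a regular version of the conditional law of `Y` given the sub-σ-algebra `m`. -/
structure IsCondLaw {Ω S : Type*} [MeasurableSpace Ω] [MeasurableSpace S]
    (P : Measure Ω) (m : MeasurableSpace Ω) (Y : Ω → S) (κ : Ω → Measure S) : Prop where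
  isProbabilityMeasure : ∀ ω, IsProbabilityMeasure (κ ω)
  measurable : Measurable[m] κ
  condExp_eq : ∀ A : Set S, MeasurableSet A →
    P⟦Y ⁻¹' A | m⟧ =ᵐ[P] fun ω => (κ ω).real A

/-- The uniform law on the orbit of `x`: the image of the normalized Haar measure of `G` by
`g ↦ g • x`. -/
noncomputable def orbitLaw (G : Type*) {E : Type*} [Group G] [TopologicalSpace G]
    [IsTopologicalGroup G] [CompactSpace G] [MeasurableSpace G] [BorelSpace G]
    [MulAction G E] [MeasurableSpace E] (x : E) : Measure E :=
  (Measure.haarMeasure (⊤ : TopologicalSpace.PositiveCompacts G)).map (fun g : G => g • x)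

end CompactWalk

/-! On the group, let A be the operator φ ↦ ∫ φ(h ·) dμ(h). The iterates Aⁿφ stay in a compact
convex set, and their L² norms for Haar measure decrease, so A preserves the norm of each limit
point ψ. By strict convexity, translating ψ by h gives Aψ for every h in the support of μ. The
elements fixing all limit points thus form a closed subgroup, which the support normalizes and of
which it meets only one coset. Since μ is spread this subgroup is G, so every limit point is
constant, equal to the Haar mean (`tendsto_iterate_average`).

For a tail event C, with Q the transition operator, n backward steps give E[1_C f(X_m)] = E[1_C
Qⁿf(X_{m-n})]. The walk almost surely never leaves its orbit, so n → ∞ shows that X_m is uniform on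
its orbit given the tail (`setIntegral_eq_orbitLaw`). Later innovations being independent of the
past, the conditional law of (X_m, later V) depends on the orbit alone (`measure_inter_future`).

Hence a bounded tail variable centered given the orbit is orthogonal to all events of (X_{-n}, V_k :
k > -n). These σ-algebras increase with n and together contain the past, so martingale convergence
makes the variable vanish: the tail is generated by the orbit (`ae_eq_zero_of_condExp_orbitSigma`).
Finally X_0 is the image of X_{-n} under innovations that preserve the uniform law, so given the
tail it is independent of V_k, k > -n, for every n (`measure_inter_inter`). -/

namespace CompactWalk

open Filter Topology

set_option linter.unusedSectionVars false

/-! ### Convergence of iterated averages on a compact group -/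

section Averages

variable {G : Type*} [Group G] [TopologicalSpace G] [IsTopologicalGroup G]

/-- The left translate `g ↦ φ (h * g)`, as a continuous linear map in `φ`. -/
def leftTranslate (h : G) : C(G, ℝ) →L[ℝ] C(G, ℝ) where
  toFun φ := φ.comp (ContinuousMap.mulLeft h)
  map_add' _ _ := rfl
  map_smul' _ _ := rfl
  cont := ContinuousMap.continuous_precomp _

@[simp]
lemma leftTranslate_apply (h g : G) (φ : C(G, ℝ)) : leftTranslate h φ g = φ (h * g) := rfl

lemma leftTranslate_one (φ : C(G, ℝ)) : leftTranslate 1 φ = φ := by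
  ext; simp

lemma leftTranslate_leftTranslate (h k : G) (φ : C(G, ℝ)) :
    leftTranslate h (leftTranslate k φ) = leftTranslate (k * h) φ := by
  ext; simp [mul_assoc]

lemma continuous_leftTranslate (φ : C(G, ℝ)) : Continuous fun h : G => leftTranslate h φ :=
  (ContinuousMap.curry ⟨fun p : G × G => φ (p.1 * p.2), by fun_prop⟩).continuous

variable [CompactSpace G] [MeasurableSpace G] [BorelSpace G]

lemma integrable_continuous {F : Type*} [NormedAddCommGroup F] (m : Measure G) [IsFiniteMeasure m]
    {f : G → F} (hf : Continuous f) : Integrable f m :=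
  hf.integrable_of_hasCompactSupport (HasCompactSupport.of_compactSpace f)

lemma norm_leftTranslate_le (h : G) (φ : C(G, ℝ)) : ‖leftTranslate h φ‖ ≤ ‖φ‖ :=
  (ContinuousMap.norm_le _ (norm_nonneg _)).2 fun _ => φ.norm_coe_le_norm _

/-- The averaging operator `φ ↦ ∫ h, φ (h * ·) ∂μ` on continuous functions. -/
noncomputable def average (μ : Measure G) [IsProbabilityMeasure μ] : C(G, ℝ) →L[ℝ] C(G, ℝ) :=
  LinearMap.mkContinuous
    { toFun := fun φ => ∫ h, leftTranslate h φ ∂μ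
      map_add' := fun φ ψ => by
        simp only [map_add]
        exact integral_add (integrable_continuous μ (continuous_leftTranslate φ))
          (integrable_continuous μ (continuous_leftTranslate ψ))
      map_smul' := fun c φ => by
        simp only [map_smul, RingHom.id_apply]
        exact integral_smul c _ }
    1 fun φ => by
      refine (norm_integral_le_of_norm_le_const (C := ‖φ‖)
        (ae_of_all _ fun h => norm_leftTranslate_le h φ)).trans ?_
      simp

variable (μ : Measure G) [IsProbabilityMeasure μ]

lemma integral_clm_leftTranslate {F : Type*} [NormedAddCommGroup F] [NormedSpace ℝ F]
    [CompleteSpace F] (Λ : C(G, ℝ) →L[ℝ] F) (φ : C(G, ℝ)) :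
    ∫ h, Λ (leftTranslate h φ) ∂μ = Λ (average μ φ) :=
  Λ.integral_comp_comm (integrable_continuous μ (continuous_leftTranslate φ))

lemma average_apply (φ : C(G, ℝ)) (g : G) : average μ φ g = ∫ h, φ (h * g) ∂μ :=
  (integral_clm_leftTranslate μ (ContinuousMap.evalCLM ℝ g) φ).symm

/-- The closed convex hull of the left translates of `φ`. -/
def translateHull (φ : C(G, ℝ)) : Set C(G, ℝ) :=
  closedConvexHull ℝ (Set.range fun h : G => leftTranslate h φ)

/-- The translates form a compact set, being a continuous image of `G`; convex hull and closure
preserve total boundedness, and `C(G, ℝ)` is complete. -/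
lemma isCompact_translateHull (φ : C(G, ℝ)) : IsCompact (translateHull φ) := by
  rw [translateHull, closedConvexHull_eq_closure_convexHull]
  have h := (isCompact_range (continuous_leftTranslate φ)).totallyBounded
  exact isCompact_iff_totallyBounded_isComplete.2
    ⟨h.convexHull.closure, isClosed_closure.isComplete⟩

lemma leftTranslate_mem_translateHull {φ ψ : C(G, ℝ)} (hψ : ψ ∈ translateHull φ) (h : G) :
    leftTranslate h ψ ∈ translateHull φ := by
  refine closedConvexHull_min (t := leftTranslate h ⁻¹' translateHull φ) ?_
    (convex_closedConvexHull.linear_preimage (leftTranslate h).toLinearMap)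
    (isClosed_closedConvexHull.preimage (leftTranslate h).continuous) hψ
  rintro _ ⟨k, rfl⟩
  exact subset_closedConvexHull ⟨k * h, (leftTranslate_leftTranslate h k φ).symm⟩

lemma average_mem_translateHull {φ ψ : C(G, ℝ)} (hψ : ψ ∈ translateHull φ) :
    average μ ψ ∈ translateHull φ :=
  convex_closedConvexHull.integral_mem isClosed_closedConvexHull
    (ae_of_all _ fun h => leftTranslate_mem_translateHull hψ h)
    (integrable_continuous μ (continuous_leftTranslate ψ))

lemma iterate_average_mem_translateHull (φ : C(G, ℝ)) (n : ℕ) :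
    (average μ)^[n] φ ∈ translateHull φ := by
  induction n with
  | zero => exact subset_closedConvexHull ⟨1, leftTranslate_one φ⟩
  | succ n ih =>
    rw [Function.iterate_succ_apply']
    exact average_mem_translateHull μ ih

/-- The limit points of the iterated averages of `φ`. -/
def averageLimits (φ : C(G, ℝ)) : Set C(G, ℝ) :=
  {ψ | MapClusterPt ψ atTop fun n : ℕ => (average μ)^[n] φ}

variable {μ} in
lemma average_mem_averageLimits {φ ψ : C(G, ℝ)} (hψ : ψ ∈ averageLimits μ φ) :
    average μ ψ ∈ averageLimits μ φ := by
  obtain ⟨U, hU, hlim⟩ := mapClusterPt_iff_ultrafilter.1 hψ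
  refine mapClusterPt_iff_ultrafilter.2 ⟨U.map (· + 1), ?_, ?_⟩
  · exact (tendsto_add_atTop_nat 1).mono_left hU
  · have := ((average μ).continuous.tendsto ψ).comp hlim
    refine tendsto_map'_iff.2 (this.congr fun n => ?_)
    simp only [Function.comp_apply, Function.iterate_succ_apply']

variable {μ} in
-- Compactness of the hull lets the iterates of index n - 1 converge along the same ultrafilter.
-- Averaging is therefore onto the set of limit points, which later gives both directions of
-- normality.
lemma exists_average_eq {φ ψ : C(G, ℝ)} (hψ : ψ ∈ averageLimits μ φ) :
    ∃ χ ∈ averageLimits μ φ, average μ χ = ψ := by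
  obtain ⟨U, hU, hlim⟩ := mapClusterPt_iff_ultrafilter.1 hψ
  obtain ⟨χ, -, hχ⟩ := (isCompact_translateHull φ).ultrafilter_le_nhds
    (U.map fun n => (average μ)^[n - 1] φ)
    (tendsto_principal.2 (Eventually.of_forall fun n =>
      iterate_average_mem_translateHull μ φ (n - 1)))
  have hχ' : Tendsto (fun n => (average μ)^[n - 1] φ) U (𝓝 χ) := hχ
  refine ⟨χ, mapClusterPt_iff_ultrafilter.2 ⟨U.map (· - 1), ?_, ?_⟩, ?_⟩
  · exact (tendsto_sub_atTop_nat 1).mono_left hU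
  · exact tendsto_map'_iff.2 hχ'
  · refine tendsto_nhds_unique (((average μ).continuous.tendsto χ).comp hχ') (hlim.congr' ?_)
    -- The truncated subtraction at n = 0 is invisible to an ultrafilter finer than `atTop`.
    filter_upwards [hU (eventually_ge_atTop 1)] with n hn
    rw [Function.comp_apply, ← Function.iterate_succ_apply' (average μ), Nat.succ_eq_add_one,
      Nat.sub_add_cancel hn]

/-- Integration against a finite measure, as a continuous linear form. -/
noncomputable def integralForm (η : Measure G) [IsFiniteMeasure η] : C(G, ℝ) →L[ℝ] ℝ :=
  LinearMap.mkContinuous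
    { toFun := fun φ => ∫ g, φ g ∂η
      map_add' := fun φ ψ => integral_add (integrable_continuous η φ.continuous)
        (integrable_continuous η ψ.continuous)
      map_smul' := fun c φ => integral_smul c _ }
    (η.real Set.univ) fun φ => by
      rw [mul_comm]
      exact norm_integral_le_of_norm_le_const (ae_of_all _ fun g => φ.norm_coe_le_norm g)

variable (η : Measure G) [IsProbabilityMeasure η] [η.IsMulLeftInvariant]

lemma integralForm_leftTranslate (h : G) (φ : C(G, ℝ)) :
    integralForm η (leftTranslate h φ) = integralForm η φ :=
  integral_mul_left_eq_self (fun g => φ g) h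

lemma integralForm_average (φ : C(G, ℝ)) :
    integralForm η (average μ φ) = integralForm η φ := by
  rw [← integral_clm_leftTranslate]
  simp [integralForm_leftTranslate]

/-- This is the variance identity for h ↦ ψ(h ·) in L²(η): by invariance all translates have the
norm of ψ, and their mean is the average. -/
lemma integral_sq_sub_average (ψ : C(G, ℝ)) :
    ∫ h, integralForm η ((leftTranslate h ψ - average μ ψ) ^ 2) ∂μ
      = integralForm η (ψ ^ 2) - integralForm η (average μ ψ ^ 2) := by
  have key : ∀ h, integralForm η ((leftTranslate h ψ - average μ ψ) ^ 2)
      = integralForm η (ψ ^ 2) + integralForm η (average μ ψ ^ 2)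
        - 2 * integralForm η (average μ ψ * leftTranslate h ψ) := by
    intro h
    have e : (leftTranslate h ψ - average μ ψ) ^ 2 = leftTranslate h (ψ ^ 2) + average μ ψ ^ 2
        - (2 : ℝ) • (average μ ψ * leftTranslate h ψ) := by
      ext g
      simp
      ring
    rw [e, map_sub, map_add, map_smul, integralForm_leftTranslate, smul_eq_mul]
  simp only [key]
  have hc : Continuous fun h => integralForm η (average μ ψ * leftTranslate h ψ) :=
    (integralForm η).continuous.comp (continuous_const.mul (continuous_leftTranslate ψ))
  have hm := integral_clm_leftTranslate μ
    ((integralForm η).comp (ContinuousLinearMap.mul ℝ C(G, ℝ) (average μ ψ))) ψ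
  simp only [ContinuousLinearMap.comp_apply, ContinuousLinearMap.mul_apply'] at hm
  rw [integral_sub (integrable_const _) ((integrable_continuous μ hc).const_mul 2),
    integral_const_mul, hm, ← sq]
  simp
  ring

lemma integralForm_sq_nonneg (ψ : C(G, ℝ)) : 0 ≤ integralForm η (ψ ^ 2) :=
  integral_nonneg fun g => by simpa using sq_nonneg (ψ g)

lemma integralForm_average_sq_le (ψ : C(G, ℝ)) :
    integralForm η (average μ ψ ^ 2) ≤ integralForm η (ψ ^ 2) := by
  have h := integral_sq_sub_average μ η ψ
  have : 0 ≤ ∫ h, integralForm η ((leftTranslate h ψ - average μ ψ) ^ 2) ∂μ :=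
    integral_nonneg fun h => integralForm_sq_nonneg η _
  linarith

variable {μ} in
lemma eq_of_mem_averageLimits {φ ψ : C(G, ℝ)} (Λ : C(G, ℝ) → ℝ) (hΛ : Continuous Λ)
    {c : ℝ} (hc : Tendsto (fun n => Λ ((average μ)^[n] φ)) atTop (𝓝 c))
    (hψ : ψ ∈ averageLimits μ φ) : Λ ψ = c := by
  obtain ⟨U, hU, hlim⟩ := mapClusterPt_iff_ultrafilter.1 hψ
  exact tendsto_nhds_unique ((hΛ.tendsto ψ).comp hlim) (hc.mono_left hU)

variable {μ} in
-- The squared norms of the iterates decrease to a limit, which is the value at every limit point;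
-- the average of ψ is another limit point.
lemma integralForm_average_sq_eq {φ ψ : C(G, ℝ)} (hψ : ψ ∈ averageLimits μ φ) :
    integralForm η (average μ ψ ^ 2) = integralForm η (ψ ^ 2) := by
  have hanti : Antitone fun n => integralForm η ((average μ)^[n] φ ^ 2) :=
    antitone_nat_of_succ_le fun n => by
      rw [Function.iterate_succ_apply']
      exact integralForm_average_sq_le μ η _
  have hlim := tendsto_atTop_ciInf hanti
    ⟨0, by rintro _ ⟨n, rfl⟩; exact integralForm_sq_nonneg η _⟩
  have hcont : Continuous fun ψ : C(G, ℝ) => integralForm η (ψ ^ 2) :=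
    (integralForm η).continuous.comp (continuous_pow 2)
  rw [eq_of_mem_averageLimits _ hcont hlim hψ,
    eq_of_mem_averageLimits _ hcont hlim (average_mem_averageLimits hψ)]

variable {μ} in
lemma integralForm_eq_of_mem_averageLimits {φ ψ : C(G, ℝ)} (hψ : ψ ∈ averageLimits μ φ) :
    integralForm η ψ = integralForm η φ := by
  refine eq_of_mem_averageLimits _ (integralForm η).continuous ?_ hψ
  refine tendsto_const_nhds.congr fun n => ?_
  induction n with
  | zero => rfl
  | succ n ih => rw [Function.iterate_succ_apply', integralForm_average, ih]

variable [η.IsOpenPosMeasure]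

lemma eq_zero_of_integralForm_sq_eq_zero {ψ : C(G, ℝ)} (h : integralForm η (ψ ^ 2) = 0) :
    ψ = 0 := by
  by_contra hne
  obtain ⟨g, hg⟩ : ∃ g, ψ g ≠ 0 := by
    by_contra! hall
    exact hne (ContinuousMap.ext hall)
  have : 0 < ∫ g, (ψ ^ 2) g ∂η :=
    (ψ ^ 2).continuous.integral_pos_of_hasCompactSupport_nonneg_nonzero
      (HasCompactSupport.of_compactSpace _) (fun g => by simpa using sq_nonneg (ψ g))
      (x := g) (by simpa using hg)
  exact this.ne' h

variable {μ} in
-- The variance of the translates is zero, so they agree with their mean μ-almost everywhere, and by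
-- continuity on the whole support.
lemma leftTranslate_eq_average (η : Measure G) [IsProbabilityMeasure η]
    [η.IsMulLeftInvariant] [η.IsOpenPosMeasure]
    {φ ψ : C(G, ℝ)} (hψ : ψ ∈ averageLimits μ φ) {h : G}
    (hh : h ∈ μ.support) : leftTranslate h ψ = average μ ψ := by
  set u : G → ℝ := fun h => integralForm η ((leftTranslate h ψ - average μ ψ) ^ 2) with hu
  have hcont : Continuous u := (integralForm η).continuous.comp
    (((continuous_leftTranslate ψ).sub continuous_const).pow 2)
  have hint : ∫ h, u h ∂μ = 0 := by
    rw [integral_sq_sub_average, integralForm_average_sq_eq η hψ, sub_self]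
  have hae : u =ᵐ[μ] 0 := (integral_eq_zero_iff_of_nonneg
    (fun h => integralForm_sq_nonneg η _) (integrable_continuous μ hcont)).1 hint
  have hzero : u h = 0 := by
    by_contra hne
    have hU : {k | u k ≠ 0} ∈ 𝓝 h := (isOpen_ne_fun hcont continuous_const).mem_nhds hne
    exact ((Measure.mem_support_iff_forall h).1 hh _ hU).ne' hae
  exact sub_eq_zero.1 (eq_zero_of_integralForm_sq_eq_zero η hzero)

/-- The elements of `G` whose translation fixes every limit point of the averages of `φ`. -/
def limitStabilizer (φ : C(G, ℝ)) : Subgroup G where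
  carrier := {g | ∀ ψ ∈ averageLimits μ φ, leftTranslate g ψ = ψ}
  one_mem' := fun ψ _ => leftTranslate_one ψ
  mul_mem' := fun {a b} ha hb ψ hψ => by
    rw [← leftTranslate_leftTranslate, ha ψ hψ, hb ψ hψ]
  inv_mem' := fun {a} ha ψ hψ => by
    conv_lhs => rw [← ha ψ hψ]
    rw [leftTranslate_leftTranslate, mul_inv_cancel, leftTranslate_one]

lemma isClosed_limitStabilizer (φ : C(G, ℝ)) : IsClosed (limitStabilizer μ φ : Set G) := by
  have : (limitStabilizer μ φ : Set G)
      = ⋂ ψ ∈ averageLimits μ φ, {g | leftTranslate g ψ = ψ} := by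
    ext g
    simp [limitStabilizer]
  rw [this]
  exact isClosed_biInter fun ψ _ => isClosed_eq (continuous_leftTranslate ψ) continuous_const

lemma isClosed_normalizer {N : Subgroup G} (hN : IsClosed (N : Set G)) :
    IsClosed ((Subgroup.normalizer (N : Set G) : Subgroup G) : Set G) := by
  have : ((Subgroup.normalizer (N : Set G) : Subgroup G) : Set G)
      = ⋂ n ∈ N, {g : G | g * n * g⁻¹ ∈ N ∧ g⁻¹ * n * g ∈ N} := by
    ext g
    simp only [SetLike.mem_coe, Subgroup.mem_normalizer_iff, Set.mem_iInter, Set.mem_ofPred_eq]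
    refine ⟨fun h n hn => ⟨(h n).1 hn, (h _).2 (by simpa [mul_assoc] using hn)⟩,
      fun h n => ⟨fun hn => (h n hn).1, fun hn => ?_⟩⟩
    simpa [mul_assoc] using (h _ hn).2
  rw [this]
  refine isClosed_biInter fun n _ => IsClosed.inter ?_ ?_
  · exact hN.preimage (f := fun g : G => g * n * g⁻¹) (by fun_prop)
  · exact hN.preimage (f := fun g : G => g⁻¹ * n * g) (by fun_prop)

/-- Each h in the support maps the set of limit points onto itself, hence normalizes the stabilizer;
the normalizer is closed, so it is `G`. All such h act on limit points in the same way, so they lie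
in one coset of this normal subgroup. -/
lemma limitStabilizer_eq_top (η : Measure G) [IsProbabilityMeasure η]
    [η.IsMulLeftInvariant] [η.IsOpenPosMeasure] (hμ : IsSpread μ) (φ : C(G, ℝ)) :
    limitStabilizer μ φ = ⊤ := by
  have hinv : ∀ (h : G) (ψ : C(G, ℝ)), leftTranslate h⁻¹ (leftTranslate h ψ) = ψ := fun h ψ => by
    rw [leftTranslate_leftTranslate, mul_inv_cancel, leftTranslate_one]
  have hsurj : ∀ h ∈ μ.support, ∀ ψ ∈ averageLimits μ φ,
      ∃ χ ∈ averageLimits μ φ, average μ χ = ψ ∧ leftTranslate h χ = ψ := by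
    intro h hh ψ hψ
    obtain ⟨χ, hχ, rfl⟩ := exists_average_eq hψ
    exact ⟨χ, hχ, rfl, leftTranslate_eq_average η hχ hh⟩
  have hnormal : (limitStabilizer μ φ).Normal := by
    rw [← Subgroup.normalizer_eq_top_iff]
    by_contra hne
    refine hμ.not_subset_subgroup _ (isClosed_normalizer (isClosed_limitStabilizer μ φ)) hne
      fun h hh => Subgroup.mem_normalizer_iff.2 fun n => ⟨fun hn ψ hψ => ?_, fun hn ψ hψ => ?_⟩
    · have hmem : leftTranslate h ψ ∈ averageLimits μ φ :=
        leftTranslate_eq_average η hψ hh ▸ average_mem_averageLimits hψ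
      rw [← leftTranslate_leftTranslate, ← leftTranslate_leftTranslate, hn _ hmem, hinv]
    · obtain ⟨χ, hχ, -, rfl⟩ := hsurj h hh ψ hψ
      have h1 := hn χ hχ
      rw [← leftTranslate_leftTranslate, ← leftTranslate_leftTranslate] at h1
      have h2 := congrArg (leftTranslate h) h1
      rwa [leftTranslate_leftTranslate h h⁻¹, inv_mul_cancel, leftTranslate_one] at h2
  by_contra hne
  -- As μ is not assumed regular, its support could be empty; it then lies in any coset.
  obtain hS | ⟨h₀, hh₀⟩ := μ.support.eq_empty_or_nonempty
  · exact hμ.not_subset_coset _ hnormal (isClosed_limitStabilizer μ φ) hne 1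
      (hS ▸ Set.empty_subset _)
  · refine hμ.not_subset_coset _ hnormal (isClosed_limitStabilizer μ φ) hne h₀ fun h hh => ?_
    rw [Set.mem_smul_set_iff_inv_smul_mem, smul_eq_mul]
    intro ψ hψ
    obtain ⟨χ, hχ, h1, h2⟩ := hsurj h₀ hh₀ ψ hψ
    rw [← leftTranslate_leftTranslate, ← h2, hinv, leftTranslate_eq_average η hχ hh, h1, h2]

/-- The iterated averages over a spread measure converge uniformly to the Haar mean. -/
theorem tendsto_iterate_average (hμ : IsSpread μ) (φ : C(G, ℝ)) :
    Tendsto (fun n => (average μ)^[n] φ) atTop (𝓝 (ContinuousMap.const G (∫ g, φ g ∂η))) := by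
  refine (isCompact_translateHull φ).tendsto_nhds_of_unique_mapClusterPt
    (Eventually.of_forall (iterate_average_mem_translateHull μ φ)) fun ψ _ hψ => ?_
  have hconst : ∀ g, ψ g = ψ 1 := fun g => by
    have hg : g ∈ limitStabilizer μ φ := by
      rw [limitStabilizer_eq_top μ η hμ]
      trivial
    simpa using DFunLike.congr_fun (hg ψ hψ) 1
  have hint : ∫ g, ψ g ∂η = ∫ g, φ g ∂η := integralForm_eq_of_mem_averageLimits η hψ
  ext g
  simp only [hconst] at hint
  rw [hconst g, ContinuousMap.const_apply, ← hint]
  simp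

end Averages

/-! ### Uniform laws on orbits and the transition operator -/

section OrbitLaw

variable {G : Type*} [Group G] [TopologicalSpace G] [IsTopologicalGroup G] [CompactSpace G]
  [MeasurableSpace G] [BorelSpace G]

/-- The normalized Haar measure. -/
noncomputable abbrev haarProb (G : Type*) [Group G] [TopologicalSpace G]
    [IsTopologicalGroup G] [CompactSpace G] [MeasurableSpace G] [BorelSpace G] : Measure G :=
  Measure.haarMeasure (⊤ : TopologicalSpace.PositiveCompacts G)

instance : IsProbabilityMeasure (haarProb G) :=
  ⟨by simpa using Measure.haarMeasure_self (K₀ := (⊤ : TopologicalSpace.PositiveCompacts G))⟩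

/-- Compact groups are unimodular: a right translate is again a Haar probability measure, and there
is only one. This makes `orbitLaw` independent of the base point. -/
lemma map_mul_right_haarProb (g : G) : (haarProb G).map (· * g) = haarProb G := by
  have : IsProbabilityMeasure ((haarProb G).map (· * g)) :=
    Measure.isProbabilityMeasure_map (measurable_mul_const g).aemeasurable
  have := Measure.isHaarMeasure_map_mul_right (haarProb G) g
  exact Measure.isHaarMeasure_eq_of_isProbabilityMeasure _ _

variable {E : Type*} [TopologicalSpace E] [SecondCountableTopology E] [MeasurableSpace E]
  [BorelSpace E] [MulAction G E] [ContinuousSMul G E]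

variable (G E) in
lemma measurable_action : Measurable fun p : G × E => p.1 • p.2 :=
  continuous_smul.measurable

lemma measurable_smul_left (x : E) : Measurable fun g : G => g • x :=
  (continuous_id.smul continuous_const).measurable

instance (x : E) : IsProbabilityMeasure (orbitLaw G x) :=
  Measure.isProbabilityMeasure_map (measurable_smul_left x).aemeasurable

lemma measurable_orbitLaw : Measurable (orbitLaw G : E → Measure E) := by
  refine Measure.measurable_of_measurable_coe _ fun A hA => ?_
  have h := measurable_measure_prodMk_right (μ := haarProb G) (measurable_action G E hA)
  refine (congrArg Measurable (funext fun x => ?_)).mpr h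
  rw [orbitLaw, Measure.map_apply (measurable_smul_left x) hA]
  rfl

lemma orbitLaw_smul (g : G) (x : E) : orbitLaw G (g • x) = orbitLaw G x := by
  have hright : orbitLaw G x = ((haarProb G).map (· * g)).map (fun h => h • x) := by
    rw [map_mul_right_haarProb]
    rfl
  rw [hright, Measure.map_map (measurable_smul_left x) (measurable_mul_const g), orbitLaw]
  congr 1
  ext h
  simp [mul_smul]

lemma map_smul_orbitLaw (g : G) (x : E) : (orbitLaw G x).map (g • ·) = orbitLaw G x := by
  have hg : Measurable fun y : E => g • y := (continuous_const_smul g).measurable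
  have hleft : orbitLaw G x = ((haarProb G).map (g * ·)).map (fun h => h • x) := by
    rw [map_mul_left_eq_self]
    rfl
  conv_rhs => rw [hleft, Measure.map_map (measurable_smul_left x) (measurable_const_mul g)]
  rw [orbitLaw, Measure.map_map hg (measurable_smul_left x)]
  congr 1
  ext h
  simp [mul_smul]

lemma integral_orbitLaw {f : E → ℝ} (hf : Continuous f) (x : E) :
    ∫ y, f y ∂orbitLaw G x = ∫ g : G, f (g • x) ∂haarProb G :=
  integral_map (measurable_smul_left x).aemeasurable hf.aestronglyMeasurable

/-- The transition operator of the walk. -/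
noncomputable def transition (μ : Measure G) (u : E → ℝ) (x : E) : ℝ := ∫ h, u (h • x) ∂μ

variable (μ : Measure G) [IsProbabilityMeasure μ]

lemma measurable_transition {u : E → ℝ} (hu : Measurable u) : Measurable (transition μ u) := by
  have h : StronglyMeasurable fun p : E × G => u (p.2 • p.1) :=
    (hu.comp ((measurable_action G E).comp measurable_swap)).stronglyMeasurable
  exact h.integral_prod_right.measurable

lemma abs_transition_le {u : E → ℝ} {c : ℝ} (hu : ∀ x, |u x| ≤ c) (x : E) :
    |transition μ u x| ≤ c := by
  simpa [transition] using norm_integral_le_of_norm_le_const (μ := μ) (f := fun h : G => u (h • x))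
    (ae_of_all _ fun h : G => hu (h • x))

lemma measurable_iterate_transition {u : E → ℝ} (hu : Measurable u) (n : ℕ) :
    Measurable ((transition μ)^[n] u) := by
  induction n with
  | zero => exact hu
  | succ n ih => rw [Function.iterate_succ_apply']; exact measurable_transition μ ih

lemma abs_iterate_transition_le {u : E → ℝ} {c : ℝ} (hu : ∀ x, |u x| ≤ c) (n : ℕ) (x : E) :
    |(transition μ)^[n] u x| ≤ c := by
  induction n generalizing x with
  | zero => exact hu x
  | succ n ih => rw [Function.iterate_succ_apply']; exact abs_transition_le μ ih x

lemma iterate_transition_smul {f : E → ℝ} {x : E} {φ : C(G, ℝ)} (h : ∀ g, f (g • x) = φ g)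
    (n : ℕ) (g : G) : (transition μ)^[n] f (g • x) = (average μ)^[n] φ g := by
  induction n generalizing g with
  | zero => exact h g
  | succ n ih =>
    rw [Function.iterate_succ_apply', Function.iterate_succ_apply', average_apply, transition]
    simp only [← mul_smul, ih]

/-- Along any sequence of points of an orbit, the iterated transition operators converge to the
mean for the uniform law on this orbit. -/
lemma tendsto_iterate_transition (hμ : IsSpread μ) {f : E → ℝ} (hf : Continuous f) (x : E)
    (y : ℕ → E) (hy : ∀ n, ∃ g : G, y n = g • x) :
    Tendsto (fun n => (transition μ)^[n] f (y n)) atTop (𝓝 (∫ z, f z ∂orbitLaw G x)) := by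
  choose g hg using hy
  set φ : C(G, ℝ) := ⟨fun g => f (g • x), by fun_prop⟩ with hφ
  have hlim := tendsto_iterate_average μ (haarProb G) hμ φ
  rw [tendsto_iff_norm_sub_tendsto_zero] at hlim ⊢
  refine squeeze_zero (fun _ => norm_nonneg _) (fun n => ?_) hlim
  rw [hg, iterate_transition_smul μ (φ := φ) (fun _ => rfl), integral_orbitLaw hf]
  -- Convergence is uniform on `G`, so the position `g n` on the orbit may vary with n.
  exact ContinuousMap.norm_coe_le_norm
    ((average μ)^[n] φ - ContinuousMap.const G (∫ g, φ g ∂haarProb G)) (g n)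

end OrbitLaw

/-! ### Completed σ-algebras and independence -/

section Completed

variable {Ω : Type*} {m m' a b p : MeasurableSpace Ω} [mΩ : MeasurableSpace Ω] {P : Measure Ω}

lemma measurableSet_completed {s : Set Ω} : MeasurableSet[completed P m] s ↔
    (∃ t, MeasurableSet[m] t ∧ s =ᵐ[P] t) ∧ MeasurableSet s :=
  MeasurableSpace.measurableSet_inf

variable (P m) in
lemma completed_le : completed P m ≤ mΩ := inf_le_right

lemma le_completed (hm : m ≤ mΩ) : m ≤ completed P m :=
  le_inf le_eventuallyMeasurableSpace hm

lemma completed_mono (h : m ≤ m') : completed P m ≤ completed P m' := fun _ hs =>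
  let ⟨⟨t, ht, hst⟩, hs'⟩ := measurableSet_completed.1 hs
  measurableSet_completed.2 ⟨⟨t, h t ht, hst⟩, hs'⟩

lemma measurableSet_completed_congr {s t : Set Ω} (ht : MeasurableSet[completed P m] t)
    (hst : s =ᵐ[P] t) (hs : MeasurableSet s) : MeasurableSet[completed P m] s :=
  let ⟨⟨r, hr, htr⟩, _⟩ := measurableSet_completed.1 ht
  measurableSet_completed.2 ⟨⟨r, hr, hst.trans htr⟩, hs⟩

lemma measurable_completed_congr {S : Type*} [MeasurableSpace S] {f g : Ω → S}
    (hg : Measurable[completed P m] g) (hfg : f =ᵐ[P] g) (hf : Measurable f) :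
    Measurable[completed P m] f := fun A hA =>
  measurableSet_completed_congr (hg hA)
    (by filter_upwards [hfg] with ω hω; exact congrArg (· ∈ A) hω) (hf hA)

lemma completed_le_completed (h : m ≤ completed P m') : completed P m ≤ completed P m' :=
  fun _ hs =>
  let ⟨⟨t, ht, hst⟩, hs'⟩ := measurableSet_completed.1 hs
  measurableSet_completed_congr (h t ht) hst hs'

lemma Indep.completed_right (h : Indep m m' P) : Indep m (completed P m') P := by
  rw [Indep_iff] at h ⊢
  intro s t hs ht
  obtain ⟨⟨r, hr, htr⟩, -⟩ := measurableSet_completed.1 ht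
  rw [measure_congr htr, measure_congr ((ae_eq_refl s).inter htr), h s r hs hr]

/-- On the π-system of intersections t ∩ u, split off u by the second hypothesis, then separate t
from c by the first. -/
lemma Indep.sup_left [IsProbabilityMeasure P]
    (ha : a ≤ mΩ) (hb : b ≤ mΩ) (hp : p ≤ mΩ)
    (h₁ : Indep a p P) (h₂ : Indep b (a ⊔ p) P) : Indep (a ⊔ b) p P := by
  have hgen : a ⊔ b = MeasurableSpace.generateFrom
      {s | ∃ t u, MeasurableSet[a] t ∧ MeasurableSet[b] u ∧ t ∩ u = s} := by
    refine le_antisymm (sup_le (fun t ht => ?_) fun u hu => ?_)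
      (MeasurableSpace.generateFrom_le ?_)
    · exact MeasurableSpace.measurableSet_generateFrom
        ⟨t, Set.univ, ht, MeasurableSet.univ, Set.inter_univ t⟩
    · exact MeasurableSpace.measurableSet_generateFrom
        ⟨Set.univ, u, MeasurableSet.univ, hu, Set.univ_inter u⟩
    · rintro _ ⟨t, u, ht, hu, rfl⟩
      exact MeasurableSet.inter (m := a ⊔ b) (le_sup_left (a := a) t ht) (le_sup_right (b := b) u hu)
  refine IndepSets.indep (sup_le ha hb) hp ?_ (@MeasurableSpace.isPiSystem_measurableSet _ p) hgen
    (@MeasurableSpace.generateFrom_measurableSet _ p).symm ?_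
  · rintro _ ⟨t, u, ht, hu, rfl⟩ _ ⟨t', u', ht', hu', rfl⟩ -
    exact ⟨t ∩ t', u ∩ u', ht.inter ht', hu.inter hu', Set.inter_inter_inter_comm _ _ _ _⟩
  · rw [IndepSets_iff]
    rintro _ c ⟨t, u, ht, hu, rfl⟩ hc
    rw [Indep_iff] at h₁ h₂
    have e₁ := h₂ u (t ∩ c) hu (MeasurableSet.inter (m := a ⊔ p)
      (le_sup_left (a := a) t ht) (le_sup_right (b := p) c hc))
    have e₂ := h₂ u t hu (le_sup_left (a := a) t ht)
    rw [show t ∩ u ∩ c = u ∩ (t ∩ c) by ext; simp; tauto, e₁, h₁ t c ht hc,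
      Set.inter_comm t u, e₂, mul_assoc]

lemma map_prodMk_restrict [IsProbabilityMeasure P] {S T : Type*} [MeasurableSpace S]
    [MeasurableSpace T] {Y : Ω → S} {W : Ω → T} (hW : Measurable W)
    (hYm : Measurable[completed P m] Y)
    (hind : Indep (MeasurableSpace.comap W inferInstance) m P) {C : Set Ω}
    (hC : MeasurableSet[completed P m] C) :
    (P.restrict C).map (fun ω => (Y ω, W ω)) = ((P.restrict C).map Y).prod (P.map W) := by
  have hY : Measurable Y := hYm.mono (completed_le m P) le_rfl
  have : IsFiniteMeasure ((P.restrict C).map Y) := inferInstance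
  have : IsProbabilityMeasure (P.map W) := Measure.isProbabilityMeasure_map hW.aemeasurable
  refine (Measure.prod_eq fun A B hA hB => ?_).symm
  rw [Measure.map_apply (hY.prodMk hW) (hA.prod hB), Measure.map_apply hY hA,
    Measure.map_apply hW hB, Measure.restrict_apply (hY.prodMk hW (hA.prod hB)),
    Measure.restrict_apply (hY hA)]
  have h := (Indep_iff _ _ _).1 (Indep.completed_right hind) (W ⁻¹' B) (Y ⁻¹' A ∩ C) ⟨B, hB, rfl⟩
    (MeasurableSet.inter (hYm hA) hC)
  rw [mul_comm, ← h]
  congr 1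
  ext ω
  simp
  tauto

end Completed

/-! ### Pasts, tails and conditional probabilities -/

section Past

variable {Ω S : Type*} [mΩ : MeasurableSpace Ω] [MeasurableSpace S] {P : Measure Ω} {Y : ℤ → Ω → S}

lemma past_le (hY : ∀ n, Measurable (Y n)) (n : ℤ) : past Y n ≤ mΩ :=
  iSup₂_le fun k _ => (hY k).comap_le

lemma past_mono {k n : ℤ} (h : k ≤ n) : past Y k ≤ past Y n :=
  iSup₂_le fun j hj => le_iSup₂_of_le j (hj.trans h) le_rfl

lemma measurable_past {k n : ℤ} (h : k ≤ n) : Measurable[past Y n] (Y k) :=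
  measurable_iff_comap_le.2
    (le_iSup₂_of_le (f := fun k (_ : k ≤ n) => MeasurableSpace.comap (Y k) inferInstance) k h le_rfl)

lemma tail_le_completed (n : ℤ) : tail P Y ≤ completed P (past Y n) := iInf_le _ n

lemma tail_le : tail P Y ≤ mΩ := (tail_le_completed 0).trans (completed_le _ P)

end Past

lemma condExp_indicator_ae_eq {Ω : Type*} {m : MeasurableSpace Ω} [mΩ : MeasurableSpace Ω]
    {P : Measure Ω} [IsProbabilityMeasure P] (hm : m ≤ mΩ) {D : Set Ω} (hD : MeasurableSet D)
    {u : Ω → ENNReal} (hu : Measurable[m] u) (hu1 : ∀ ω, u ω ≤ 1)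
    (h : ∀ C, MeasurableSet[m] C → P (C ∩ D) = ∫⁻ ω in C, u ω ∂P) :
    P⟦D | m⟧ =ᵐ[P] fun ω => (u ω).toReal := by
  have hint : Integrable (fun ω => (u ω).toReal) P :=
    Integrable.of_bound (hu.mono hm le_rfl).ennreal_toReal.aestronglyMeasurable 1
      (ae_of_all _ fun ω => by
        rw [Real.norm_of_nonneg ENNReal.toReal_nonneg]
        exact ENNReal.toReal_le_of_le_ofReal zero_le_one (by simpa using hu1 ω))
  refine (ae_eq_condExp_of_forall_setIntegral_eq hm ((integrable_const 1).indicator hD)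
    (fun C _ _ => hint.integrableOn) (fun C hC _ => ?_)
    hu.ennreal_toReal.stronglyMeasurable.aestronglyMeasurable).symm
  rw [integral_toReal (hu.mono hm le_rfl).aemeasurable
    (ae_of_all _ fun ω => (hu1 ω).trans_lt ENNReal.one_lt_top), ← h C hC,
    setIntegral_indicator hD]
  simp [measureReal_def]

/-! ### The walk driven by its later innovations -/

section Future

variable {Ω G E : Type*}

/-- The sequence of innovations after time `m`. -/
def future (V : ℤ → Ω → G) (m : ℤ) (ω : Ω) (j : ℕ) : G := V (m + 1 + j) ω

/-- The effect of the first `n` innovations `v 0, …, v (n - 1)` on a state. -/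
def run [SMul G E] : ℕ → (ℕ → G) → E → E
  | 0, _, x => x
  | n + 1, v, x => v n • run n v x

end Future

section Walk

variable {G : Type*} [Group G] [TopologicalSpace G] [IsTopologicalGroup G] [CompactSpace G]
  [MeasurableSpace G] [BorelSpace G]
  {E : Type*} [TopologicalSpace E] [PolishSpace E] [MeasurableSpace E] [BorelSpace E]
  [MulAction G E] [ContinuousSMul G E]

/-- Innovations act one at a time because the action is jointly measurable, `E` being second
countable; multiplication of `G` need not be so for the product σ-algebra. -/
lemma measurable_run (n : ℕ) : Measurable fun p : E × (ℕ → G) => run n p.2 p.1 := by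
  induction n with
  | zero => exact measurable_fst
  | succ n ih =>
    exact (measurable_action G E).comp
      (((measurable_pi_apply n).comp measurable_snd).prodMk ih)

lemma measurable_run_left (n : ℕ) (v : ℕ → G) : Measurable fun x : E => run n v x :=
  (measurable_run n).comp measurable_prodMk_right

lemma map_run_orbitLaw (n : ℕ) (v : ℕ → G) (x : E) :
    (orbitLaw G x).map (run n v) = orbitLaw G x := by
  induction n with
  | zero => exact Measure.map_id
  | succ n ih =>
    have hg : Measurable fun y : E => v n • y := (continuous_const_smul (v n)).measurable
    change (orbitLaw G x).map ((v n • ·) ∘ run n v) = _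
    rw [← Measure.map_map hg (measurable_run_left n v), ih, map_smul_orbitLaw]

variable {μ : Measure G} [IsProbabilityMeasure μ] {Ω : Type*} [mΩ : MeasurableSpace Ω]
  {P : Measure Ω} [IsProbabilityMeasure P] {X : ℤ → Ω → E} {V : ℤ → Ω → G}

namespace IsWalk

lemma measurable_pair (hX : IsWalk P μ X V) (n : ℤ) : Measurable fun ω => (X n ω, V n ω) :=
  (hX.measurable_X n).prodMk (hX.measurable_V n)

lemma past_pair_le (hX : IsWalk P μ X V) (n : ℤ) : past (fun k ω => (X k ω, V k ω)) n ≤ mΩ :=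
  past_le hX.measurable_pair n

lemma measurable_past_X {k n : ℤ} (h : k ≤ n) :
    Measurable[past (fun k ω => (X k ω, V k ω)) n] (X k) :=
  measurable_fst.comp (measurable_past (Y := fun k ω => (X k ω, V k ω)) h)

lemma measurable_past_V {k n : ℤ} (h : k ≤ n) :
    Measurable[past (fun k ω => (X k ω, V k ω)) n] (V k) :=
  measurable_snd.comp (measurable_past (Y := fun k ω => (X k ω, V k ω)) h)

lemma measurable_future (hX : IsWalk P μ X V) (m : ℤ) : Measurable (future V m) :=
  measurable_pi_lambda _ fun _ => hX.measurable_V _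

/-- Each new innovation is independent of the past together with the innovations already added, so
finite blocks follow by induction and the whole future by a monotone limit. -/
lemma indep_future (hX : IsWalk P μ X V) (m : ℤ) :
    Indep (MeasurableSpace.comap (future V m) inferInstance)
      (past (fun k ω => (X k ω, V k ω)) m) P := by
  set H : ℕ → MeasurableSpace Ω := fun n =>
    ⨆ (j : ℕ) (_ : j < n), MeasurableSpace.comap (V (m + 1 + j)) inferInstance with hH
  have hH_le : ∀ n, H n ≤ mΩ := fun n => iSup₂_le fun j _ => (hX.measurable_V _).comap_le
  have hmono : Monotone H := fun a b hab =>
    iSup₂_le fun j hj => le_iSup₂_of_le j (hj.trans_le hab) le_rfl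
  have hsucc : ∀ n, H (n + 1) = H n ⊔ MeasurableSpace.comap (V (m + 1 + n)) inferInstance := by
    intro n
    refine le_antisymm (iSup₂_le fun j hj => ?_) (sup_le (hmono n.le_succ)
      (le_iSup₂_of_le n n.lt_succ_self le_rfl))
    rcases Nat.lt_succ_iff_lt_or_eq.1 hj with h | rfl
    · exact le_sup_of_le_left (le_iSup₂_of_le j h le_rfl)
    · exact le_sup_right
  have hH_past : ∀ n : ℕ, H n ≤ past (fun k ω => (X k ω, V k ω)) (m + n) := fun n =>
    iSup₂_le fun j hj => (measurable_past_V (by lia)).comap_le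
  have hind : ∀ n, Indep (H n) (past (fun k ω => (X k ω, V k ω)) m) P := by
    intro n
    induction n with
    | zero =>
      have : H 0 = ⊥ := by simp [hH]
      rw [this]
      exact indep_bot_left _
    | succ n ih =>
      rw [hsucc]
      refine Indep.sup_left (hH_le n) (hX.measurable_V _).comap_le (hX.past_pair_le m) ih ?_
      have h := hX.indep_past (m + n)
      rw [show m + n + 1 = m + 1 + n by ring] at h
      exact indep_of_indep_of_le_right h (sup_le (hH_past n) (past_mono (by lia)))
  refine indep_of_indep_of_le_left
    (indep_iSup_of_monotone hind hH_le (hX.past_pair_le m) hmono) (Measurable.comap_le ?_)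
  refine @measurable_pi_lambda _ _ _ (_) _ _ fun j => measurable_iff_comap_le.2 ?_
  exact le_iSup_of_le (j + 1) (le_iSup₂_of_le (f := fun (j' : ℕ) (_ : j' < j + 1) =>
    MeasurableSpace.comap (V (m + 1 + j')) inferInstance) j j.lt_succ_self le_rfl)

lemma ae_orbit (hX : IsWalk P μ X V) :
    ∀ᵐ ω ∂P, ∀ m n : ℤ, ∃ g : G, X n ω = g • X m ω := by
  filter_upwards [ae_all_iff.2 hX.step] with ω hω
  have h0 : ∀ n : ℤ, ∃ g : G, X n ω = g • X 0 ω := by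
    intro n
    induction n using Int.induction_on with
    | zero => exact ⟨1, (one_smul G _).symm⟩
    | succ n ih =>
      obtain ⟨g, hg⟩ := ih
      exact ⟨V (n + 1) ω * g, by rw [hω, hg, mul_smul]⟩
    | pred n ih =>
      obtain ⟨g, hg⟩ := ih
      have h := hω (-n - 1)
      rw [sub_add_cancel] at h
      exact ⟨(V (-n) ω)⁻¹ * g, by rw [mul_smul, ← hg, h, inv_smul_smul]⟩
  intro m n
  obtain ⟨g, hg⟩ := h0 n
  obtain ⟨h, hh⟩ := h0 m
  exact ⟨g * h⁻¹, by rw [hg, hh, mul_smul, inv_smul_smul]⟩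

lemma ae_eq_run (hX : IsWalk P μ X V) (m : ℤ) (n : ℕ) :
    ∀ᵐ ω ∂P, X (m + n) ω = run n (future V m ω) (X m ω) := by
  filter_upwards [ae_all_iff.2 hX.step] with ω hω
  induction n with
  | zero => simp [run]
  | succ n ih =>
    rw [Nat.cast_succ, ← add_assoc, hω, ih, run, future, add_right_comm]

lemma setIntegral_succ (hX : IsWalk P μ X V) {u : E → ℝ} (hu : Measurable u) {c : ℝ}
    (hc : ∀ x, |u x| ≤ c) {k : ℤ} {C : Set Ω}
    (hC : MeasurableSet[completed P (past (fun k ω => (X k ω, V k ω)) k)] C) :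
    ∫ ω in C, u (X (k + 1) ω) ∂P = ∫ ω in C, transition μ u (X k ω) ∂P := by
  have hlaw := map_prodMk_restrict (hX.measurable_V (k + 1))
    ((measurable_past_X le_rfl).mono (le_completed (hX.past_pair_le k)) le_rfl)
    (hX.indep_past k) hC
  have hm : Measurable fun p : E × G => u (p.2 • p.1) :=
    hu.comp ((measurable_action G E).comp measurable_swap)
  rw [hX.map_V] at hlaw
  have h1 : ∫ ω in C, u (X (k + 1) ω) ∂P = ∫ ω in C, u (V (k + 1) ω • X k ω) ∂P :=
    integral_congr_ae (ae_restrict_of_ae ((hX.step k).mono fun ω hω => congrArg u hω))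
  rw [h1, ← integral_map (φ := fun ω => (X k ω, V (k + 1) ω)) (f := fun p => u (p.2 • p.1))
    ((hX.measurable_X k).prodMk (hX.measurable_V _)).aemeasurable hm.aestronglyMeasurable, hlaw,
    integral_prod _ (Integrable.of_bound hm.aestronglyMeasurable c (ae_of_all _ fun p => hc _)),
    ← integral_map (φ := X k) (f := transition μ u) (hX.measurable_X k).aemeasurable
      (measurable_transition μ hu).aestronglyMeasurable]
  rfl

/-- A tail event belongs to every completed past, so the one-step Markov property can be applied
backward indefinitely. -/
lemma setIntegral_iterate (hX : IsWalk P μ X V) {u : E → ℝ} (hu : Measurable u) {c : ℝ}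
    (hc : ∀ x, |u x| ≤ c) {C : Set Ω}
    (hC : MeasurableSet[tail P (fun k ω => (X k ω, V k ω))] C) (m : ℤ) (n : ℕ) :
    ∫ ω in C, u (X m ω) ∂P = ∫ ω in C, (transition μ)^[n] u (X (m - n) ω) ∂P := by
  induction n with
  | zero => simp
  | succ n ih =>
    have h := hX.setIntegral_succ (measurable_iterate_transition μ hu n)
      (abs_iterate_transition_le μ hc n) (k := m - (n + 1 : ℕ)) (tail_le_completed _ C hC)
    rw [show m - (n + 1 : ℕ) + 1 = m - n by push_cast; ring] at h
    rw [ih, h, Function.iterate_succ_apply']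

lemma setIntegral_eq_orbitLaw (hX : IsWalk P μ X V) (hμ : IsSpread μ)
    (f : BoundedContinuousFunction E ℝ) {C : Set Ω}
    (hC : MeasurableSet[tail P (fun k ω => (X k ω, V k ω))] C) (m : ℤ) :
    ∫ ω in C, f (X m ω) ∂P = ∫ ω in C, ∫ y, f y ∂orbitLaw G (X m ω) ∂P := by
  have hu : Measurable f := f.continuous.measurable
  have hc : ∀ x, |f x| ≤ ‖f‖ := f.norm_coe_le_norm
  have hlim : Tendsto (fun n : ℕ => ∫ ω in C, (transition μ)^[n] f (X (m - n) ω) ∂P) atTop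
      (𝓝 (∫ ω in C, ∫ y, f y ∂orbitLaw G (X m ω) ∂P)) := by
    refine tendsto_integral_of_dominated_convergence (fun _ => ‖f‖) (fun n => ?_)
      (integrable_const _) (fun n => ae_of_all _ fun ω => abs_iterate_transition_le μ hc n _) ?_
    · exact ((measurable_iterate_transition μ hu n).comp
        (hX.measurable_X _)).aestronglyMeasurable
    · refine ae_restrict_of_ae ?_
      filter_upwards [hX.ae_orbit] with ω hω
      exact tendsto_iterate_transition μ hμ f.continuous (X m ω) _ fun n => hω m (m - n)
  exact tendsto_nhds_unique
    (tendsto_const_nhds.congr fun n => hX.setIntegral_iterate hu hc hC m n) hlim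

/-- The uniform laws on the orbits, as a Markov kernel. -/
noncomputable def _root_.CompactWalk.orbitKernel (G E : Type*) [Group G] [TopologicalSpace G]
    [IsTopologicalGroup G] [CompactSpace G] [MeasurableSpace G] [BorelSpace G]
    [TopologicalSpace E] [SecondCountableTopology E] [MeasurableSpace E]
    [BorelSpace E] [MulAction G E] [ContinuousSMul G E] : Kernel E E where
  toFun := orbitLaw G
  measurable' := measurable_orbitLaw

instance : IsMarkovKernel (orbitKernel G E) :=
  ⟨fun x => inferInstanceAs (IsProbabilityMeasure (orbitLaw G x))⟩

/-- Conditionally on a tail event, the law of `X m` is a mixture of uniform laws on orbits. -/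
lemma map_restrict_eq_bind (hX : IsWalk P μ X V) (hμ : IsSpread μ) {C : Set Ω}
    (hC : MeasurableSet[tail P (fun k ω => (X k ω, V k ω))] C) (m : ℤ) :
    (P.restrict C).map (X m) = ((P.restrict C).map (X m)).bind (orbitKernel G E) := by
  rw [← Measure.snd_compProd]
  -- Finite Borel measures on `E` are determined by bounded continuous functions, the class for
  -- which the limit was taken.
  refine ext_of_forall_integral_eq_of_IsFiniteMeasure fun f => ?_
  have hf : Measurable f := f.continuous.measurable
  have hint : Integrable (fun p : E × E => f p.2)
      (((P.restrict C).map (X m)).compProd (orbitKernel G E)) :=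
    Integrable.of_bound (hf.comp measurable_snd).aestronglyMeasurable ‖f‖
      (ae_of_all _ fun p => f.norm_coe_le_norm _)
  rw [Measure.snd, integral_map measurable_snd.aemeasurable hf.aestronglyMeasurable,
    Measure.integral_compProd hint, integral_map (hX.measurable_X m).aemeasurable
      hf.aestronglyMeasurable, integral_map (hX.measurable_X m).aemeasurable]
  · exact hX.setIntegral_eq_orbitLaw hμ f hC m
  · exact (hf.stronglyMeasurable.comp_measurable measurable_snd).integral_kernel_prod_right'
      |>.aestronglyMeasurable

/-- Conditionally on the tail, the state at time `m` is uniform on its orbit and independent of the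
innovations after time `m`. -/
lemma measure_inter_future (hX : IsWalk P μ X V) (hμ : IsSpread μ) {C : Set Ω}
    (hC : MeasurableSet[tail P (fun k ω => (X k ω, V k ω))] C) (m : ℤ)
    {S : Set (E × (ℕ → G))} (hS : MeasurableSet S) :
    P (C ∩ (fun ω => (X m ω, future V m ω)) ⁻¹' S)
      = ∫⁻ ω in C, ((orbitLaw G (X m ω)).prod (P.map (future V m))) S ∂P := by
  have : IsProbabilityMeasure (P.map (future V m)) :=
    Measure.isProbabilityMeasure_map (hX.measurable_future m).aemeasurable
  have hpair : Measurable fun ω => (X m ω, future V m ω) :=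
    (hX.measurable_X m).prodMk (hX.measurable_future m)
  have hlaw := map_prodMk_restrict (hX.measurable_future m)
    ((measurable_past_X le_rfl).mono (le_completed (hX.past_pair_le m)) le_rfl)
    (hX.indep_future m) (tail_le_completed m C hC)
  have hsec : Measurable fun y => (P.map (future V m)) (Prod.mk y ⁻¹' S) :=
    measurable_measure_prodMk_left hS
  rw [Set.inter_comm, ← Measure.restrict_apply (hpair hS), ← Measure.map_apply hpair hS, hlaw,
    hX.map_restrict_eq_bind hμ hC m, Measure.prod_apply hS,
    Measure.lintegral_bind (orbitKernel G E).measurable.aemeasurable hsec.aemeasurable,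
    lintegral_map (hsec.lintegral_kernel) (hX.measurable_X m)]
  exact lintegral_congr fun ω => (Measure.prod_apply hS).symm

end IsWalk

end Walk

/-! ### The tail is generated by the orbit -/

lemma measurableSet_completed_of_null {Ω : Type*} {m : MeasurableSpace Ω} [mΩ : MeasurableSpace Ω]
    {P : Measure Ω} {s : Set Ω} (hs : MeasurableSet s) (h : P s = 0) :
    MeasurableSet[completed P m] s :=
  measurableSet_completed.2 ⟨⟨∅, @MeasurableSet.empty _ m, ae_eq_empty.2 h⟩, hs⟩

/-- A σ-algebra containing all measurable null events is already complete, since s is recovered from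
t by adding and removing null sets. -/
lemma completed_le_self {Ω : Type*} {m m' : MeasurableSpace Ω} [mΩ : MeasurableSpace Ω]
    {P : Measure Ω} (hm : m ≤ mΩ) (h : completed P m' ≤ m) : completed P m ≤ m := by
  intro s hs
  obtain ⟨⟨t, ht, hst⟩, hs'⟩ := measurableSet_completed.1 hs
  obtain ⟨h1, h2⟩ := ae_eq_set.1 hst
  have e : s = (t ∪ s \ t) \ (t \ s) := by
    ext ω
    simp
    tauto
  rw [e]
  exact (ht.union (h _ (measurableSet_completed_of_null (hs'.diff (hm t ht)) h1))).diff
    (h _ (measurableSet_completed_of_null ((hm t ht).diff hs') h2))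

section Walk

variable {G : Type*} [Group G] [TopologicalSpace G] [IsTopologicalGroup G] [CompactSpace G]
  [MeasurableSpace G] [BorelSpace G]
  {E : Type*} [TopologicalSpace E] [PolishSpace E] [MeasurableSpace E] [BorelSpace E]
  [MulAction G E] [ContinuousSMul G E]

/-- An invariant map descends to the orbit space, and the descended map is measurable because the
quotient σ-algebra is the largest possible. -/
lemma measurable_orbitSigma {Ω S : Type*} [MeasurableSpace S] {Z : Ω → E} {u : E → S}
    (hu : Measurable u) (hinv : ∀ (g : G) x, u (g • x) = u x) :
    Measurable[orbitSigma G Z] fun ω => u (Z ω) := by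
  let q : Quotient (MulAction.orbitRel G E) → S :=
    Quotient.lift u fun a b hab => by
      obtain ⟨g, rfl⟩ := hab
      exact hinv g b
  intro A hA
  exact ⟨q ⁻¹' A, hu hA, rfl⟩

variable {μ : Measure G} [IsProbabilityMeasure μ] {Ω : Type*} {F O : MeasurableSpace Ω}
  [mΩ : MeasurableSpace Ω] {P : Measure Ω} [IsProbabilityMeasure P] {X : ℤ → Ω → E} {V : ℤ → Ω → G}

namespace IsWalk

lemma measurable_orbitSigma_completed (hX : IsWalk P μ X V) {S : Type*} [MeasurableSpace S]
    {u : E → S} (hu : Measurable u) (hinv : ∀ (g : G) x, u (g • x) = u x) (m : ℤ) :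
    Measurable[completed P (orbitSigma G (X 0))] fun ω => u (X m ω) := by
  have hle : orbitSigma G (X 0) ≤ mΩ := by
    rintro _ ⟨D, hD, rfl⟩
    exact hX.measurable_X 0 hD
  refine measurable_completed_congr ((measurable_orbitSigma (Z := X 0) hu hinv).mono
    (le_completed hle) le_rfl) ?_ (hu.comp (hX.measurable_X m))
  filter_upwards [hX.ae_orbit] with ω hω
  obtain ⟨g, hg⟩ := hω 0 m
  rw [hg, hinv]

lemma ae_orbitLaw_eq (hX : IsWalk P μ X V) (m n : ℤ) :
    ∀ᵐ ω ∂P, orbitLaw G (X m ω) = orbitLaw G (X n ω) := by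
  filter_upwards [hX.ae_orbit] with ω hω
  obtain ⟨g, hg⟩ := hω n m
  rw [hg, orbitLaw_smul]

lemma completed_orbitSigma_le_tail (hX : IsWalk P μ X V) :
    completed P (orbitSigma G (X 0)) ≤ tail P X := by
  refine le_iInf fun n => completed_le_completed ?_
  rintro _ ⟨D, hD, rfl⟩
  refine measurableSet_completed_congr (t := X n ⁻¹' (Quotient.mk _ ⁻¹' D))
    (le_completed (past_le hX.measurable_X n) _ (measurable_past le_rfl hD)) ?_
    (hX.measurable_X 0 hD)
  filter_upwards [hX.ae_orbit] with ω hω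
  obtain ⟨g, hg⟩ := hω n 0
  have : Quotient.mk (MulAction.orbitRel G E) (X 0 ω) = Quotient.mk _ (X n ω) :=
    Quotient.sound ⟨g, hg.symm⟩
  exact congrArg (· ∈ D) this

lemma tail_le_tail_pair :
    tail P X ≤ tail P (fun n ω => (X n ω, V n ω)) :=
  iInf_mono fun _ => completed_mono (iSup₂_le fun _ hk => (measurable_past_X hk).comap_le)

lemma measurable_prod_orbitLaw {T : Type*} [MeasurableSpace T] (l : Measure T)
    [IsProbabilityMeasure l] {S : Set (E × T)} (hS : MeasurableSet S) :
    Measurable fun x : E => ((orbitLaw G x).prod l) S := by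
  simp only [Measure.prod_apply hS]
  exact (Measure.measurable_lintegral (measurable_measure_prodMk_left hS)).comp measurable_orbitLaw

/-- The σ-algebra generated by the state at time `-n` and the later innovations. -/
@[reducible]
def stateFuture (X : ℤ → Ω → E) (V : ℤ → Ω → G) (n : ℕ) : MeasurableSpace Ω :=
  MeasurableSpace.comap (fun ω => (X (-n) ω, future V (-n) ω)) inferInstance

lemma stateFuture_le (hX : IsWalk P μ X V) (n : ℕ) : stateFuture X V n ≤ mΩ :=
  ((hX.measurable_X _).prodMk (hX.measurable_future _)).comap_le

lemma measurable_stateFuture_X (n : ℕ) : Measurable[stateFuture X V n] (X (-n)) :=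
  measurable_fst.comp (comap_measurable _)

lemma measurable_stateFuture_V {n : ℕ} {k : ℤ} (hk : -n < k) :
    Measurable[stateFuture X V n] (V k) := by
  -- Coordinate j of `future V (-n)` is the innovation at time -n + 1 + j.
  have h : Measurable[stateFuture X V n] fun ω => future V (-n) ω (k + n - 1).toNat :=
    (measurable_pi_apply _).comp (measurable_snd.comp
      (comap_measurable (fun ω => (X (-n) ω, future V (-n) ω))))
  convert h using 2 with ω
  rw [future]
  congr 1
  lia

/-- The state at -n is recovered from the state at -(n + 1) and one innovation, but only almost
surely; hence the completions. -/
lemma monotone_completed_stateFuture (hX : IsWalk P μ X V) :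
    Monotone fun n => completed P (stateFuture X V n) := by
  refine monotone_nat_of_le_succ fun n => completed_le_completed (Measurable.comap_le ?_)
  have hle := le_completed (P := P) (hX.stateFuture_le (n + 1))
  refine Measurable.prodMk ?_ (@measurable_pi_lambda _ _ _ (_) _ _ fun j =>
    (measurable_stateFuture_V (by push_cast; lia)).mono hle le_rfl)
  have h : Measurable[completed P (stateFuture X V (n + 1))]
      fun ω => V (-n) ω • X (-(n + 1 : ℕ)) ω :=
    ((measurable_action G E).comp ((measurable_stateFuture_V (by push_cast; lia)).prodMk
      (measurable_stateFuture_X (n + 1)))).mono hle le_rfl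
  refine measurable_completed_congr h ?_ (hX.measurable_X _)
  filter_upwards [hX.step (-(n + 1 : ℕ))] with ω hω
  rwa [show -((n + 1 : ℕ) : ℤ) + 1 = -n by push_cast; ring] at hω

lemma past_le_iSup_stateFuture (hX : IsWalk P μ X V) :
    past (fun k ω => (X k ω, V k ω)) 0 ≤ ⨆ n, completed P (stateFuture X V n) := by
  have hle : ∀ n, stateFuture X V n ≤ ⨆ n, completed P (stateFuture X V n) := fun n =>
    (le_completed (hX.stateFuture_le n)).trans
      (le_iSup (fun n => completed P (stateFuture X V n)) n)
  refine iSup₂_le fun k hk => Measurable.comap_le (Measurable.prodMk ?_ ?_)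
  · have h := measurable_stateFuture_X (X := X) (V := V) (-k).toNat
    rw [show -((-k).toNat : ℤ) = k by lia] at h
    exact h.mono (hle _) le_rfl
  · exact (measurable_stateFuture_V (n := (1 - k).toNat) (by lia)).mono (hle _) le_rfl

/-- An integrable tail variable centered given the orbit of `X 0` vanishes. -/
lemma ae_eq_zero_of_condExp_orbitSigma (hX : IsWalk P μ X V) (hμ : IsSpread μ) {g : Ω → ℝ} {c : ℝ}
    (hF : F = tail P (fun k ω => (X k ω, V k ω))) (hO : O = completed P (orbitSigma G (X 0)))
    (hg : StronglyMeasurable[F] g) (hc : ∀ᵐ ω ∂P, |g ω| ≤ c) (h0 : P[g | O] =ᵐ[P] 0) :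
    g =ᵐ[P] 0 := by
  have hFΩ : F ≤ mΩ := hF ▸ tail_le
  have hOF : O ≤ F := hF ▸ hO ▸ hX.completed_orbitSigma_le_tail.trans tail_le_tail_pair
  have hgint : Integrable g P := Integrable.of_bound (hg.mono hFΩ).aestronglyMeasurable c hc
  let ℱ : Filtration ℕ mΩ :=
    ⟨fun n => completed P (stateFuture X V n), hX.monotone_completed_stateFuture,
      fun n => completed_le _ P⟩
  -- Here P(D | F) = u is measurable for the smaller σ-algebra `O`, so E[g 1_D] = E[g u] = E[u E[g |
  -- O]] = 0.
  have hrect : ∀ (n : ℕ) (S : Set (E × (ℕ → G))), MeasurableSet S →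
      ∫ ω in (fun ω => (X (-n) ω, future V (-n) ω)) ⁻¹' S, g ω ∂P = 0 := by
    intro n S hS
    set D := (fun ω => (X (-n) ω, future V (-n) ω)) ⁻¹' S with hD
    have hDm : MeasurableSet D := (hX.measurable_X _).prodMk (hX.measurable_future _) hS
    have : IsProbabilityMeasure (P.map (future V (-n))) :=
      Measure.isProbabilityMeasure_map (hX.measurable_future _).aemeasurable
    set u : Ω → ENNReal := fun ω => ((orbitLaw G (X (-n) ω)).prod (P.map (future V (-n)))) S
    have hu : Measurable[O] u := hO ▸ hX.measurable_orbitSigma_completed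
      (measurable_prod_orbitLaw (P.map (future V (-n))) hS) (fun g x => by rw [orbitLaw_smul]) (-n)
    have hcond : P⟦D | F⟧ =ᵐ[P] fun ω => (u ω).toReal :=
      condExp_indicator_ae_eq hFΩ hDm (hu.mono hOF le_rfl) (fun ω => prob_le_one)
        fun C hC => hX.measure_inter_future hμ (hF ▸ hC) (-n) hS
    have hur : StronglyMeasurable[O] fun ω => (u ω).toReal := hu.ennreal_toReal.stronglyMeasurable
    have hu1 : ∀ ω, ‖(u ω).toReal‖ ≤ 1 := fun ω => by
      rw [Real.norm_of_nonneg ENNReal.toReal_nonneg]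
      exact ENNReal.toReal_le_of_le_ofReal zero_le_one (by simpa using prob_le_one)
    have hprod1 : Integrable (g * D.indicator fun _ => (1 : ℝ)) P := by
      refine (hgint.indicator hDm).congr (ae_of_all _ fun ω => ?_)
      by_cases h : ω ∈ D <;> simp [h]
    have hprod2 : Integrable ((fun ω => (u ω).toReal) * g) P :=
      hgint.bdd_mul ((hur.mono (hOF.trans hFΩ)).aestronglyMeasurable) (ae_of_all _ hu1)
    have e1 := condExp_mul_of_stronglyMeasurable_left hg hprod1 ((integrable_const 1).indicator hDm)
    have e2 := condExp_mul_of_stronglyMeasurable_left hur hprod2 hgint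
    calc ∫ ω in D, g ω ∂P = ∫ ω, (g * D.indicator fun _ => (1 : ℝ)) ω ∂P := by
          rw [← integral_indicator hDm]
          refine integral_congr_ae (ae_of_all _ fun ω => ?_)
          by_cases h : ω ∈ D <;> simp [h]
      _ = ∫ ω, (P[g * D.indicator fun _ => (1 : ℝ) | F]) ω ∂P := (integral_condExp hFΩ).symm
      _ = ∫ ω, ((fun ω => (u ω).toReal) * g) ω ∂P := by
          refine integral_congr_ae ?_
          filter_upwards [e1, hcond] with ω h1 h2
          rw [h1, Pi.mul_apply, h2, Pi.mul_apply, mul_comm]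
      _ = ∫ ω, (P[(fun ω => (u ω).toReal) * g | O]) ω ∂P := (integral_condExp (hOF.trans hFΩ)).symm
      _ = 0 := by
          refine integral_eq_zero_of_ae ?_
          filter_upwards [e2, h0] with ω h1 h2
          rw [h1, Pi.mul_apply, h2]
          simp
  have hzero : ∀ n, P[g | ℱ n] =ᵐ[P] 0 := by
    intro n
    refine (ae_eq_condExp_of_forall_setIntegral_eq (ℱ.le n) hgint
      (fun s _ _ => (integrable_zero _ _ _).integrableOn) (fun s hs _ => ?_)
      stronglyMeasurable_zero.aestronglyMeasurable).symm
    obtain ⟨⟨_, ⟨S, hS, rfl⟩, hst⟩, -⟩ := measurableSet_completed.1 hs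
    rw [setIntegral_congr_set (f := g) hst, hrect n S hS]
    simp
  have hsup : (⨆ n, ℱ n : MeasurableSpace Ω) ≤ mΩ := iSup_le ℱ.le
  have hFsup : F ≤ ⨆ n, ℱ n :=
    hF ▸ (tail_le_completed 0).trans ((completed_mono hX.past_le_iSup_stateFuture).trans
      (completed_le_self hsup (le_iSup (fun n => completed P (stateFuture X V n)) 0)))
  have hg' : P[g | ⨆ n, ℱ n] = g := condExp_of_stronglyMeasurable hsup (hg.mono hFsup) hgint
  -- Lévy's upward theorem: the conditional expectations of g, all zero, converge to g itself.
  filter_upwards [tendsto_ae_condExp (ℱ := ℱ) g, ae_all_iff.2 hzero] with ω h1 h2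
  rw [hg'] at h1
  exact tendsto_nhds_unique h1 (tendsto_const_nhds.congr fun n => (h2 n).symm)

/-- The tail of the joint process is generated by the orbit of `X 0`, up to negligible events. -/
lemma le_of_eq_tail_of_eq_completed (hX : IsWalk P μ X V) (hμ : IsSpread μ)
    (hF : F = tail P (fun k ω => (X k ω, V k ω))) (hO : O = completed P (orbitSigma G (X 0))) :
    F ≤ O := by
  have hFΩ : F ≤ mΩ := hF ▸ tail_le
  have hOF : O ≤ F := hF ▸ hO ▸ hX.completed_orbitSigma_le_tail.trans tail_le_tail_pair
  have hOΩ : O ≤ mΩ := hOF.trans hFΩ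
  intro C hC
  have hCm : MeasurableSet C := hFΩ _ hC
  have hint : Integrable (C.indicator fun _ => (1 : ℝ)) P := (integrable_const 1).indicator hCm
  have hψ : StronglyMeasurable[O] (P⟦C | O⟧) := stronglyMeasurable_condExp
  have hbound : ∀ᵐ ω ∂P, |(P⟦C | O⟧) ω| ≤ 1 := by
    refine ae_bdd_abs_condExp_of_ae_bdd_abs (R := 1) (ae_of_all _ fun ω => ?_)
    by_cases h : ω ∈ C <;> simp [h]
  -- The bound 2 adds the bounds 1 for the indicator and for its conditional expectation.
  have hzero := hX.ae_eq_zero_of_condExp_orbitSigma hμ hF hO (c := 2)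
    (g := (C.indicator fun _ => (1 : ℝ)) - P⟦C | O⟧)
    ((stronglyMeasurable_const.indicator hC).sub (hψ.mono hOF))
    (by
      filter_upwards [hbound] with ω hω
      refine (abs_sub _ _).trans ?_
      have : |C.indicator (fun _ => (1 : ℝ)) ω| ≤ 1 := by by_cases h : ω ∈ C <;> simp [h]
      linarith)
    (by
      filter_upwards [condExp_sub (m := O) hint (integrable_condExp (m := O)
        (f := C.indicator fun _ => (1 : ℝ)) (μ := P))] with ω hω
      rw [hω, condExp_of_stronglyMeasurable hOΩ hψ integrable_condExp]
      simp)
  -- Once the indicator of `C` equals P(C | O) almost surely, this level set is an event of `O` that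
  -- agrees with `C`.
  have hset : MeasurableSet[O] {ω | (P⟦C | O⟧) ω = 1} :=
    hψ.measurable (measurableSet_singleton (1 : ℝ))
  rw [hO] at hset ⊢
  refine measurableSet_completed_congr hset ?_ hCm
  rw [← hO]
  filter_upwards [hzero] with ω hω
  refine propext (?_ : ω ∈ C ↔ (P⟦C | O⟧) ω = 1)
  have h : (P⟦C | O⟧) ω = C.indicator (fun _ => (1 : ℝ)) ω := (sub_eq_zero.1 hω).symm
  rw [h]
  by_cases hωC : ω ∈ C <;> simp [hωC]

/-! ### Conditional law of the state and independence from the innovations -/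

/-- Write X_0 as X_{-n} moved by the innovations since -n. For each fixed v the map `run n v`
preserves the uniform law, so the section over v has measure `orbitLaw G x A` whatever v ∈ B. -/
lemma measure_inter_inter_future (hX : IsWalk P μ X V) (hμ : IsSpread μ) {C : Set Ω}
    (hC : MeasurableSet[tail P (fun k ω => (X k ω, V k ω))] C) {A : Set E} (hA : MeasurableSet A)
    (n : ℕ) {B : Set (ℕ → G)} (hB : MeasurableSet B) :
    P (C ∩ X 0 ⁻¹' A ∩ future V (-n) ⁻¹' B)
      = (∫⁻ ω in C, orbitLaw G (X 0 ω) A ∂P) * P (future V (-n) ⁻¹' B) := by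
  have : IsProbabilityMeasure (P.map (future V (-n))) :=
    Measure.isProbabilityMeasure_map (hX.measurable_future _).aemeasurable
  set S : Set (E × (ℕ → G)) := {p | run n p.2 p.1 ∈ A} ∩ Prod.snd ⁻¹' B with hSdef
  have hS : MeasurableSet S := (measurable_run n hA).inter (measurable_snd hB)
  have hval : ∀ x : E, ((orbitLaw G x).prod (P.map (future V (-n)))) S
      = orbitLaw G x A * P (future V (-n) ⁻¹' B) := by
    intro x
    have hsec : ∀ v : ℕ → G, orbitLaw G x ((fun y => (y, v)) ⁻¹' S)
        = B.indicator (fun _ => orbitLaw G x A) v := by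
      intro v
      by_cases hv : v ∈ B
      · have e : (fun y => (y, v)) ⁻¹' S = run n v ⁻¹' A := by
          ext y
          simp [hSdef, hv]
        rw [e, ← Measure.map_apply (measurable_run_left n v) hA, map_run_orbitLaw,
          Set.indicator_of_mem hv]
      · have e : (fun y => (y, v)) ⁻¹' S = ∅ := by
          ext y
          simp [hSdef, hv]
        rw [e, measure_empty, Set.indicator_of_notMem hv]
    rw [Measure.prod_apply_symm hS]
    simp only [hsec]
    rw [lintegral_indicator_const hB, Measure.map_apply (hX.measurable_future _) hB]
  have h := hX.measure_inter_future hμ hC (-n) hS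
  simp only [hval] at h
  have hmeas : ∀ k : ℤ, Measurable fun ω => orbitLaw G (X k ω) A := fun k =>
    (Measure.measurable_coe hA).comp (measurable_orbitLaw.comp (hX.measurable_X k))
  rw [lintegral_mul_const _ (hmeas (-n))] at h
  have hlaw : ∫⁻ ω in C, orbitLaw G (X (-n) ω) A ∂P = ∫⁻ ω in C, orbitLaw G (X 0 ω) A ∂P := by
    refine lintegral_congr_ae (ae_restrict_of_ae ?_)
    filter_upwards [hX.ae_orbitLaw_eq (-n) 0] with ω hω
    rw [hω]
  rw [hlaw] at h
  rw [← h]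
  refine measure_congr ?_
  filter_upwards [hX.ae_eq_run (-n) n] with ω hω
  rw [neg_add_cancel] at hω
  refine propext (?_ : (ω ∈ C ∧ X 0 ω ∈ A) ∧ future V (-n) ω ∈ B ↔
    ω ∈ C ∧ run n (future V (-n) ω) (X (-n) ω) ∈ A ∧ future V (-n) ω ∈ B)
  rw [← hω, and_assoc]

/-- Given a tail event, `X 0` is uniform on its orbit and independent of all the innovations. -/
lemma measure_inter_inter (hX : IsWalk P μ X V) (hμ : IsSpread μ) {C : Set Ω}
    (hC : MeasurableSet[tail P (fun k ω => (X k ω, V k ω))] C) {A : Set E} (hA : MeasurableSet A)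
    {B : Set (ℤ → G)} (hB : MeasurableSet B) :
    P (C ∩ (X 0 ⁻¹' A ∩ (fun ω n => V n ω) ⁻¹' B))
      = (∫⁻ ω in C, orbitLaw G (X 0 ω) A ∂P) * P ((fun ω n => V n ω) ⁻¹' B) := by
  have hV : Measurable fun ω (n : ℤ) => V n ω := measurable_pi_lambda _ hX.measurable_V
  set c := ∫⁻ ω in C, orbitLaw G (X 0 ω) A ∂P with hc
  have hc1 : c ≠ ⊤ := by
    refine ((lintegral_mono fun ω => prob_le_one).trans_lt ?_).ne
    simp
  have : IsFiniteMeasure (c • P.map fun ω (n : ℤ) => V n ω) := Measure.smul_finite _ hc1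
  have key : (P.restrict (C ∩ X 0 ⁻¹' A)).map (fun ω (n : ℤ) => V n ω)
      = c • P.map fun ω (n : ℤ) => V n ω := by
    -- Finite measures on the product are determined by their finite-dimensional marginals, and
    -- finitely many times all come after some -n.
    refine IsProjectiveLimit.unique
      (P := fun I => (c • P.map fun ω (n : ℤ) => V n ω).map I.restrict) (fun I => ?_) fun I => rfl
    obtain ⟨n, hn⟩ : ∃ n : ℕ, ∀ i ∈ I, -(n : ℤ) < i := by
      refine ⟨∑ i ∈ I, i.natAbs + 1, fun i hi => ?_⟩
      have := Finset.single_le_sum (f := Int.natAbs) (fun _ _ => Nat.zero_le _) hi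
      lia
    let r : (ℕ → G) → (I → G) := fun v i => v ((i : ℤ) + n - 1).toNat
    have hr : Measurable r := measurable_pi_lambda _ fun _ => measurable_pi_apply _
    have hcomp : I.restrict ∘ (fun ω (n : ℤ) => V n ω) = r ∘ future V (-n) := by
      funext ω i
      have := hn i i.2
      simp only [Function.comp_apply, Finset.restrict, r, future]
      congr 1
      lia
    have hres : Measurable (I.restrict (π := fun _ : ℤ => G)) := Finset.measurable_restrict I
    change _ = (c • P.map fun ω (n : ℤ) => V n ω).map I.restrict
    rw [Measure.map_map hres hV, Measure.map_smul, Measure.map_map hres hV, hcomp]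
    ext B hB
    have hfut := hr.comp (hX.measurable_future (-n))
    rw [Measure.map_apply hfut hB, Measure.restrict_apply (hfut hB), Measure.smul_apply,
      Measure.map_apply hfut hB, Set.inter_comm, Set.preimage_comp,
      hX.measure_inter_inter_future hμ hC hA n (hr hB), smul_eq_mul]
  have h := congrArg (fun l => l B) key
  simp only [Measure.map_apply hV hB, Measure.restrict_apply (hV hB), Measure.smul_apply,
    smul_eq_mul] at h
  rw [← h, Set.inter_comm (_ ⁻¹' B), Set.inter_assoc]

/-- The conditional probability is a product whose second factor is constant; taking `A` or `B` to
be everything yields both marginals. -/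
lemma condExp_inter (hX : IsWalk P μ X V) (hμ : IsSpread μ) {A : Set E} (hA : MeasurableSet A)
    {B : Set (ℤ → G)} (hB : MeasurableSet B) :
    P⟦X 0 ⁻¹' A ∩ (fun ω n => V n ω) ⁻¹' B | tail P (fun k ω => (X k ω, V k ω))⟧
      =ᵐ[P] fun ω => (orbitLaw G (X 0 ω)).real A * P.real ((fun ω n => V n ω) ⁻¹' B) := by
  have hV : Measurable fun ω (n : ℤ) => V n ω := measurable_pi_lambda _ hX.measurable_V
  have hlaw : Measurable[tail P (fun k ω => (X k ω, V k ω))] fun ω => orbitLaw G (X 0 ω) A :=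
    (hX.measurable_orbitSigma_completed (u := fun x => orbitLaw G x A)
      ((Measure.measurable_coe hA).comp measurable_orbitLaw)
      (fun g x => by rw [orbitLaw_smul]) 0).mono
      (hX.completed_orbitSigma_le_tail.trans tail_le_tail_pair) le_rfl
  have h := condExp_indicator_ae_eq (P := P) tail_le ((hX.measurable_X 0 hA).inter (hV hB))
    (u := fun ω => orbitLaw G (X 0 ω) A * P ((fun ω n => V n ω) ⁻¹' B)) (hlaw.mul_const _)
    (fun ω => mul_le_one' prob_le_one prob_le_one) (fun C hC => by
      rw [hX.measure_inter_inter hμ hC hA hB,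
        lintegral_mul_const _ (hlaw.mono tail_le le_rfl)])
  simpa only [ENNReal.toReal_mul, measureReal_def] using h

end IsWalk

end Walk

end CompactWalk

theorem mainTheorem6
    {G : Type*} [Group G] [TopologicalSpace G] [IsTopologicalGroup G] [CompactSpace G] [T2Space G]
    [MeasurableSpace G] [BorelSpace G]
    {E : Type*} [TopologicalSpace E] [PolishSpace E] [MeasurableSpace E] [BorelSpace E]
    [MulAction G E] [ContinuousSMul G E]
    (μ : Measure G) [IsProbabilityMeasure μ] (hμ : CompactWalk.IsSpread μ)
    {Ω : Type*} [MeasurableSpace Ω] (P : Measure Ω) [IsProbabilityMeasure P]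
    (X : ℤ → Ω → E) (V : ℤ → Ω → G) (hX : CompactWalk.IsWalk P μ X V) :
    CompactWalk.tail P (fun n ω => (X n ω, V n ω))
        = CompactWalk.completed P (CompactWalk.orbitSigma G (X 0)) ∧
      CompactWalk.tail P X = CompactWalk.completed P (CompactWalk.orbitSigma G (X 0)) ∧
      CompactWalk.CondIndepGiven P (CompactWalk.tail P (fun n ω => (X n ω, V n ω)))
        (X 0) (fun ω n => V n ω) ∧
      CompactWalk.IsCondLaw P (CompactWalk.tail P (fun n ω => (X n ω, V n ω)))
        (X 0) (fun ω => CompactWalk.orbitLaw G (X 0 ω)) := by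
  -- The orbit σ-algebra lies in the tail of X, which lies in the joint tail, which `hle` puts back
  -- in the orbit σ-algebra: all three coincide.
  have hge := hX.completed_orbitSigma_le_tail
  have hmid := CompactWalk.IsWalk.tail_le_tail_pair (P := P) (X := X) (V := V)
  have hle := hX.le_of_eq_tail_of_eq_completed hμ rfl rfl
  have hlaw : ∀ A : Set E, MeasurableSet A →
      P⟦X 0 ⁻¹' A | CompactWalk.tail P (fun n ω => (X n ω, V n ω))⟧
        =ᵐ[P] fun ω => (CompactWalk.orbitLaw G (X 0 ω)).real A := fun A hA => by
    simpa using hX.condExp_inter hμ hA MeasurableSet.univ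
  refine ⟨le_antisymm hle (hge.trans hmid), le_antisymm (hmid.trans hle) hge,
    fun A B hA hB => ?_, ⟨fun ω => inferInstance, ?_, hlaw⟩⟩
  · have hB' := hX.condExp_inter hμ MeasurableSet.univ hB
    simp only [Set.preimage_univ, Set.univ_inter, probReal_univ, one_mul] at hB'
    filter_upwards [hX.condExp_inter hμ hA hB, hlaw A hA, hB'] with ω h1 h2 h3
    rw [h1, h2, h3]
  · exact (hX.measurable_orbitSigma_completed CompactWalk.measurable_orbitLaw
      CompactWalk.orbitLaw_smul 0).mono (hge.trans hmid) le_rfl
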